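/- Let $K$ be a global field of characteristic zero, i.e. either a number field, or a finite extension of a rational function field $k(t)$ with $k$ an arbitrary field of characteristic zero. If $K$ is a number field, its primes are the nonzero prime ideals of its ring of integers $\mathfrak o_K$. If $K$ is a function field, its primes are the discrete valuation rings containing $k$ with field of fractions $K$; in this case fix one prime $\mathfrak p_0$ and put $\mathfrak o_K=\{z\in K: v_{\mathfrak p}(z)\ge 0 \text{ for all primes } \mathfrak p\ne\mathfrak p_0\}$. Here $v_{\mathfrak p}$ is the normalized valuation of $\mathfrak p$. Let $S$ be a set of quadratic polynomials in $\mathfrak o_K[x]$ with a common critical point $c\in\mathfrak o_K$, let $\gamma=(\theta_i)_{i\ge1}$ be a sequence of elements of $S$, and write $\gamma_0^+=x$ and $\gamma_m^+=\theta_1\circ\theta_2\circ\cdots\circ\theta_m$ for $m\ge1$. Let $T_\gamma$ be the graph whose vertices are the $\alpha\in\overline K$ with $\gamma_m^+(\alpha)=0$ for some $m\ge0$ (so that $0$ is the root), with an edge between $\alpha$ and $\theta_m(\alpha)$ whenever $m\ge1$ and $\gamma_m^+(\alpha)=0$. Let $K_\gamma\subseteq\overline K$ be the union of the splitting fields $K_{\gamma,n}$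 of $\gamma_n^+$ over $K$, and let $G_{\gamma,K}=\mathrm{Gal}(K_\gamma/K)=\varprojlim_n\mathrm{Gal}(K_{\gamma,n}/K)$, which acts on $T_\gamma$ by graph automorphisms. Assume that $\gamma_m^+$ is irreducible over $K$ for all $m\ge1$, and that for all sufficiently large $n$ there is a prime $\mathfrak p=\mathfrak p_{\gamma,n}$ of $K$ such that 1. $v_{\mathfrak p}(2)=0$; 2. $\mathfrak p\ne\mathfrak p_0$ if $K$ is a function field; 3. $v_{\mathfrak p}(\ell(\theta_m))=0$ for all $1\le m\le n$, where $\ell(\theta_m)$ is the leading coefficient of $\theta_m$; 4. $v_{\mathfrak p}(\gamma_m^+(c))=0$ for all $1\le m\le n-1$; 5. $v_{\mathfrak p}(\gamma_n^+(c))$ is an odd integer. Then the homomorphism $G_{\gamma,K}\to\mathrm{Aut}(T_\gamma)$ is injective and its image is a subgroup of finite index; that is, $G_{\gamma,K}$ is a finite index subgroup of $\mathrm{Aut}(T_\gamma)$. -/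

import Mathlib

open Polynomial NumberField IsDedekindDomain
open scoped WithZero

noncomputable section

namespace Arboreal

universe u v

section Tree

variable {K : Type u} [Field K]

/-- Right iteration. A sequence `(θ_1, θ_2, …)` is encoded with a shift of the index, `θ i` being
`θ_{i+1}`; then `rightIter θ n = θ_1 ∘ ⋯ ∘ θ_n`, and `rightIter θ 0 = X` is the identity. -/
def rightIter (θ : ℕ → K[X]) : ℕ → K[X]
  | 0 => X
  | n + 1 => (rightIter θ n).comp (θ n)

/-- The splitting field, inside the algebraic closure of `K`, of the `n`-th right iterate. -/
def levelField (θ : ℕ → K[X]) (n : ℕ) : IntermediateField K (AlgebraicClosure K) :=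
  IntermediateField.adjoin K ((rightIter θ n).rootSet (AlgebraicClosure K))

/-- The union of the tower of the splitting fields `levelField θ n`. -/
def treeField (θ : ℕ → K[X]) : IntermediateField K (AlgebraicClosure K) :=
  ⨆ n, levelField θ n

/-- The vertices of the preimage tree: the zeros in the algebraic closure of the right iterates.
The iterate of index `0` contributes the root `0` of the tree. -/
def Vertex (θ : ℕ → K[X]) : Type u :=
  {α : AlgebraicClosure K // ∃ m, α ∈ (rightIter θ m).rootSet (AlgebraicClosure K)}

/-- The complete preimage tree: a zero `α` of `θ_1 ∘ ⋯ ∘ θ_m`, `m ≥ 1`, is joined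
to `θ_m(α)`. -/
def preimageTree (θ : ℕ → K[X]) : SimpleGraph (Vertex θ) :=
  SimpleGraph.fromRel fun α β =>
    ∃ m, α.1 ∈ (rightIter θ (m + 1)).rootSet (AlgebraicClosure K) ∧ β.1 = aeval α.1 (θ m)

theorem mem_treeField (θ : ℕ → K[X]) {m : ℕ} {α : AlgebraicClosure K}
    (h : α ∈ (rightIter θ m).rootSet (AlgebraicClosure K)) : α ∈ treeField θ :=
  le_iSup (levelField θ) m (IntermediateField.subset_adjoin K _ h)

theorem Vertex.mem (θ : ℕ → K[X]) (α : Vertex θ) : α.1 ∈ treeField θ :=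
  α.2.elim fun _ h => mem_treeField θ h

theorem aeval_galois (θ : ℕ → K[X]) (σ : treeField θ ≃ₐ[K] treeField θ) (x : treeField θ)
    (p : K[X]) :
    aeval (σ x : AlgebraicClosure K) p = (σ (aeval x p) : AlgebraicClosure K) := by
  have h1 : aeval (σ x) p = σ (aeval x p) := aeval_algHom_apply σ.toAlgHom x p
  have h2 : aeval ((treeField θ).val (σ x)) p = (treeField θ).val (aeval (σ x) p) :=
    aeval_algHom_apply (treeField θ).val (σ x) p
  rw [h1] at h2
  exact h2

theorem galois_mem_rootSet (θ : ℕ → K[X]) (σ : treeField θ ≃ₐ[K] treeField θ)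
    (x : treeField θ) (p : K[X])
    (h : (x : AlgebraicClosure K) ∈ p.rootSet (AlgebraicClosure K)) :
    (σ x : AlgebraicClosure K) ∈ p.rootSet (AlgebraicClosure K) := by
  rw [mem_rootSet] at h ⊢
  refine ⟨h.1, ?_⟩
  have h0 : aeval x p = 0 := by
    have h2 : aeval ((treeField θ).val x) p = (treeField θ).val (aeval x p) :=
      aeval_algHom_apply (treeField θ).val x p
    have h3 : (treeField θ).val (aeval x p) = 0 := h2.symm.trans h.2
    exact (treeField θ).val.injective (h3.trans (map_zero _).symm)
  rw [aeval_galois, h0, map_zero]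
  rfl

/-- The action of the Galois group of `treeField θ` over `K` on the vertices. -/
def galoisVertex (θ : ℕ → K[X]) (σ : treeField θ ≃ₐ[K] treeField θ) (α : Vertex θ) :
    Vertex θ :=
  ⟨σ ⟨α.1, Vertex.mem θ α⟩,
    α.2.imp fun _ h => galois_mem_rootSet θ σ ⟨α.1, Vertex.mem θ α⟩ _ h⟩

theorem galoisVertex_mul (θ : ℕ → K[X]) (σ τ : treeField θ ≃ₐ[K] treeField θ) (α : Vertex θ) :
    galoisVertex θ (σ * τ) α = galoisVertex θ σ (galoisVertex θ τ α) := rfl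

theorem galoisVertex_one (θ : ℕ → K[X]) (α : Vertex θ) : galoisVertex θ 1 α = α := rfl

theorem galoisVertex_injective (θ : ℕ → K[X]) (σ : treeField θ ≃ₐ[K] treeField θ) :
    Function.Injective (galoisVertex θ σ) := by
  intro α β h
  have h' := congrArg (galoisVertex θ σ⁻¹) h
  rwa [← galoisVertex_mul, ← galoisVertex_mul, inv_mul_cancel, galoisVertex_one,
    galoisVertex_one] at h'

theorem galoisVertex_adj (θ : ℕ → K[X]) (σ : treeField θ ≃ₐ[K] treeField θ) {α β : Vertex θ}
    (h : (preimageTree θ).Adj α β) :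
    (preimageTree θ).Adj (galoisVertex θ σ α) (galoisVertex θ σ β) := by
  have key : ∀ a b : Vertex θ,
      (∃ m, a.1 ∈ (rightIter θ (m + 1)).rootSet (AlgebraicClosure K) ∧
        b.1 = aeval a.1 (θ m)) →
      ∃ m, (galoisVertex θ σ a).1 ∈ (rightIter θ (m + 1)).rootSet (AlgebraicClosure K) ∧
        (galoisVertex θ σ b).1 = aeval (galoisVertex θ σ a).1 (θ m) := by
    rintro a b ⟨m, h1, h2⟩
    refine ⟨m, galois_mem_rootSet θ σ ⟨a.1, Vertex.mem θ a⟩ _ h1, ?_⟩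
    have h5 : aeval a.1 (θ m) =
        (treeField θ).val (aeval (⟨a.1, Vertex.mem θ a⟩ : treeField θ) (θ m)) :=
      aeval_algHom_apply (treeField θ).val (⟨a.1, Vertex.mem θ a⟩ : treeField θ) (θ m)
    have h4 : (⟨b.1, Vertex.mem θ b⟩ : treeField θ)
        = aeval (⟨a.1, Vertex.mem θ a⟩ : treeField θ) (θ m) :=
      Subtype.ext (h2.trans h5)
    exact (congrArg (fun x => (σ x : AlgebraicClosure K)) h4).trans
      (aeval_galois θ σ ⟨a.1, Vertex.mem θ a⟩ (θ m)).symm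
  rw [preimageTree, SimpleGraph.fromRel_adj] at h ⊢
  exact ⟨fun e => h.1 (galoisVertex_injective θ σ e), h.2.imp (key α β) (key β α)⟩

/-- The arboreal representation: the homomorphism to the automorphism group of the preimage tree
given by the action of the Galois group on the vertices. -/
def arborealRep (θ : ℕ → K[X]) :
    (treeField θ ≃ₐ[K] treeField θ) →* (preimageTree θ ≃g preimageTree θ) where
  toFun σ :=
    { toFun := galoisVertex θ σ
      invFun := galoisVertex θ σ⁻¹
      left_inv := fun α => by
        rw [← galoisVertex_mul, inv_mul_cancel, galoisVertex_one]
      right_inv := fun α => by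
        rw [← galoisVertex_mul, mul_inv_cancel, galoisVertex_one]
      map_rel_iff' := by
        intro α β
        refine ⟨fun h => ?_, fun h => galoisVertex_adj θ σ h⟩
        have h' := galoisVertex_adj θ σ⁻¹ h
        simp only [Equiv.coe_fn_mk] at h'
        rwa [← galoisVertex_mul, ← galoisVertex_mul, inv_mul_cancel, galoisVertex_one,
          galoisVertex_one] at h' }
  map_one' := RelIso.ext fun α => galoisVertex_one θ α
  map_mul' σ τ := RelIso.ext fun α => galoisVertex_mul θ σ τ α

end Tree

section Primes

/-- `S` is a set of quadratic polynomials with coefficients in the subring `R` of `K`, and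
`c ∈ R` is a common critical point of them. -/
def IsQuadraticSet {K : Type u} [Field K] (R : Subring K) (S : Set K[X]) (c : K) : Prop :=
  c ∈ R ∧ ∀ f ∈ S, f.natDegree = 2 ∧ (∀ i, f.coeff i ∈ R) ∧ f.derivative.eval c = 0

/-- A prime of the function field `K` over `k`: a discrete valuation ring with field of
fractions `K` that contains the constants `k`. -/
structure FunctionFieldPrime (k : Type v) (K : Type u) [Field k] [Field K]
    [Algebra (RatFunc k) K] where
  ring : ValuationSubring K
  const_mem : ∀ a : k, algebraMap (RatFunc k) K (RatFunc.C a) ∈ ring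
  isDVR : IsDiscreteValuationRing ring

variable {k : Type v} {K : Type u} [Field k] [Field K] [Algebra (RatFunc k) K]

/-- The normalized valuation of a prime of a function field, written multiplicatively: an additive
value `j : ℤ` is `WithZero.exp (-j)`, and `∞` is `0`. -/
def FunctionFieldPrime.valuation (𝔭 : FunctionFieldPrime k K) : Valuation K ℤᵐ⁰ :=
  haveI := 𝔭.isDVR
  (IsDiscreteValuationRing.maximalIdeal 𝔭.ring).valuation K

/-- The elements of a function field that are integral away from one chosen prime. -/
def integersAway (𝔭₀ : FunctionFieldPrime k K) : Subring K where
  carrier := {z | ∀ 𝔭 : FunctionFieldPrime k K, 𝔭 ≠ 𝔭₀ → 𝔭.valuation z ≤ 1}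
  mul_mem' ha hb 𝔭 h := 𝔭.valuation.integer.mul_mem (ha 𝔭 h) (hb 𝔭 h)
  one_mem' 𝔭 _ := 𝔭.valuation.integer.one_mem
  add_mem' ha hb 𝔭 h := 𝔭.valuation.integer.add_mem (ha 𝔭 h) (hb 𝔭 h)
  zero_mem' 𝔭 _ := 𝔭.valuation.integer.zero_mem
  neg_mem' ha 𝔭 h := 𝔭.valuation.integer.neg_mem (ha 𝔭 h)

/-- The conditions on the (multiplicatively written) normalized valuation `v` of a prime at
index `n`: the values at `2`, at the leading coefficients of `θ_1, …, θ_n`, and at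
`θ_1 ∘ ⋯ ∘ θ_m (c)` for `1 ≤ m ≤ n - 1` are trivial, while the value at
`θ_1 ∘ ⋯ ∘ θ_n (c)` is odd. -/
def IsGoodAt {K : Type u} [Field K] (v : Valuation K ℤᵐ⁰) (θ : ℕ → K[X]) (c : K) (n : ℕ) : Prop :=
  v 2 = 1 ∧
  (∀ i < n, v (θ i).leadingCoeff = 1) ∧
  (∀ m, 1 ≤ m → m < n → v ((rightIter θ m).eval c) = 1) ∧
  ∃ j : ℤ, Odd j ∧ v ((rightIter θ n).eval c) = WithZero.exp (-j)

end Primes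

end Arboreal

end

/-! Completing the square, every `θ m` is `a * (X - c) ^ 2 + b`, so the children of a vertex `x` of
level `m` are `c ± r` with `r = radical θ c m x` and `r ^ 2 = (x - b) / a`. Passing from level `n`
to level `n + 1` is thus a Kummer problem: automorphisms over `levelField θ n` act on the radicals
of level `n` by signs, giving a subspace of the vectors over `ZMod 2` indexed by the level.

If this subspace is proper, the linear relations it satisfies form a nonzero space on which a
2-group acts, the image of Galois in the permutations of level `n`. Such an action has a nonzero
fixed relation, and irreducibility makes the action on the level transitive, so the fixed relation
is the all-ones vector. Then the product of all the radicals of level `n` lies in `levelField θ n`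
(`relations_eq_bot`, `exists_flip_eq`).

A good prime at `n + 1` excludes this (`prod_radical_notMem`). The square of the product has the
same value as the iterate of index `n + 1` at `c`, which is odd, whereas the prime does not ramify
in `levelField θ n`: that field lies in a tower of square roots of units, with 2 a unit.

Hence for large `n` every sign pattern occurs, and a tree automorphism trivial on level `N` can be
matched by Galois one level at a time (`exists_agree_succ`). Compactness gives one Galois element
matching it on all levels, so the image contains the kernel of the action on a finite level. -/

noncomputable section

namespace Arboreal

universe u

/-! ### Quadratic sequences, levels and their radicals. -/

section Quadratic

variable {K : Type u} [Field K]

theorem eq_quadratic {f : K[X]} {c : K} (hf : f.natDegree = 2) (hc : f.derivative.eval c = 0) :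
    f = C f.leadingCoeff * (X - C c) ^ 2 + C (f.eval c) := by
  have h := f.as_sum_range_C_mul_X_pow
  rw [hf] at h
  simp only [Finset.sum_range_succ, Finset.sum_range_zero, pow_zero, mul_one, pow_one,
    zero_add] at h
  have hl : f.leadingCoeff = f.coeff 2 := by rw [leadingCoeff, hf]
  rw [hl]
  generalize f.coeff 0 = p at *
  generalize f.coeff 1 = q at *
  generalize f.coeff 2 = r at *
  subst h
  have hq : q = -(2 * r * c) := by
    simp at hc
    linear_combination hc
  subst hq
  simp only [eval_add, eval_mul, eval_C, eval_X, eval_pow, eval_neg, eval_ofNat, map_add, map_mul,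
    map_pow, map_neg, map_ofNat]
  ring

theorem aeval_quadratic {f : K[X]} {c : K} (hf : f.natDegree = 2)
    (hc : f.derivative.eval c = 0) {L : Type*} [Field L] [Algebra K L] (y : L) :
    aeval y f = algebraMap K L f.leadingCoeff * (y - algebraMap K L c) ^ 2
      + algebraMap K L (f.eval c) := by
  conv_lhs => rw [eq_quadratic hf hc]
  simp

/-- A sequence of quadratic polynomials with critical point `c`, all of whose right iterates are
irreducible. -/
structure IsIrreducibleSequence (θ : ℕ → K[X]) (c : K) : Prop where
  natDegree_eq : ∀ i, (θ i).natDegree = 2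
  critical : ∀ i, (θ i).derivative.eval c = 0
  irreducible : ∀ m, Irreducible (rightIter θ m)

/-- The zeros of the `m`-th right iterate in the algebraic closure. -/
abbrev level (θ : ℕ → K[X]) (m : ℕ) : Set (AlgebraicClosure K) :=
  (rightIter θ m).rootSet (AlgebraicClosure K)

/-- A square root of `(x - θ_m(c)) / a_m`, where `a_m` is the leading coefficient of `θ m`. -/
def radical (θ : ℕ → K[X]) (c : K) (m : ℕ) (x : AlgebraicClosure K) : AlgebraicClosure K :=
  (IsAlgClosed.exists_pow_nat_eq ((x - algebraMap K _ ((θ m).eval c)) /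
    algebraMap K _ (θ m).leadingCoeff) two_pos).choose

theorem radical_sq (θ : ℕ → K[X]) (c : K) (m : ℕ) (x : AlgebraicClosure K) :
    radical θ c m x ^ 2 = (x - algebraMap K _ ((θ m).eval c)) /
      algebraMap K _ (θ m).leadingCoeff :=
  (IsAlgClosed.exists_pow_nat_eq ((x - algebraMap K _ ((θ m).eval c)) /
    algebraMap K _ (θ m).leadingCoeff) two_pos).choose_spec

/-- The square roots are chosen arbitrarily, so equivariance holds only up to sign. -/
theorem map_radical (θ : ℕ → K[X]) (c : K) (m : ℕ) (x : AlgebraicClosure K)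
    (σ : AlgebraicClosure K ≃ₐ[K] AlgebraicClosure K) :
    σ (radical θ c m x) = radical θ c m (σ x) ∨ σ (radical θ c m x) = -radical θ c m (σ x) := by
  rw [← sq_eq_sq_iff_eq_or_eq_neg, ← map_pow, radical_sq, radical_sq]
  simp

theorem aeval_rightIter_succ (θ : ℕ → K[X]) (m : ℕ) {L : Type*} [Field L] [Algebra K L] (x : L) :
    aeval x (rightIter θ (m + 1)) = aeval (aeval x (θ m)) (rightIter θ m) := by
  rw [rightIter, aeval_comp]

namespace IsIrreducibleSequence

variable {θ : ℕ → K[X]} {c : K} (h : IsIrreducibleSequence θ c)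
include h

theorem natDegree_rightIter (m : ℕ) : (rightIter θ m).natDegree = 2 ^ m := by
  induction m with
  | zero => simp [rightIter]
  | succ m ih => rw [rightIter, natDegree_comp, ih, h.natDegree_eq, pow_succ]

theorem mem_level {m : ℕ} {x : AlgebraicClosure K} :
    x ∈ level θ m ↔ aeval x (rightIter θ m) = 0 := by
  rw [mem_rootSet_of_ne (h.irreducible m).ne_zero]

theorem mem_level_succ {m : ℕ} {x : AlgebraicClosure K} :
    x ∈ level θ (m + 1) ↔ aeval x (θ m) ∈ level θ m := by
  rw [h.mem_level, h.mem_level, aeval_rightIter_succ]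

theorem natDegree_minpoly {m : ℕ} {x : AlgebraicClosure K} (hx : x ∈ level θ m) :
    (minpoly K x).natDegree = 2 ^ m := by
  rw [← minpoly.eq_of_irreducible (h.irreducible m) (h.mem_level.1 hx), ← h.natDegree_rightIter m]
  exact natDegree_mul_leadingCoeff_inv _ (h.irreducible m).ne_zero

/-- Irreducibility makes the degree `2 ^ m` of a zero over `K` determine its level. -/
theorem level_unique {m n : ℕ} {x : AlgebraicClosure K} (hm : x ∈ level θ m)
    (hn : x ∈ level θ n) : m = n :=
  Nat.pow_right_injective le_rfl ((h.natDegree_minpoly hm).symm.trans (h.natDegree_minpoly hn))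

theorem lead_ne_zero (m : ℕ) :
    algebraMap K (AlgebraicClosure K) (θ m).leadingCoeff ≠ 0 := by
  have : θ m ≠ 0 := fun e => by simpa [e] using h.natDegree_eq m
  simpa using this

theorem aeval_eq_iff {m : ℕ} {x y : AlgebraicClosure K} :
    aeval y (θ m) = x ↔ (y - algebraMap K _ c) ^ 2 = radical θ c m x ^ 2 := by
  rw [aeval_quadratic (h.natDegree_eq m) (h.critical m), radical_sq,
    eq_div_iff (h.lead_ne_zero m), mul_comm, eq_sub_iff_add_eq]

theorem aeval_eq_iff_or {m : ℕ} {x y : AlgebraicClosure K} :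
    aeval y (θ m) = x ↔
      y = algebraMap K _ c + radical θ c m x ∨ y = algebraMap K _ c - radical θ c m x := by
  rw [h.aeval_eq_iff, sq_eq_sq_iff_eq_or_eq_neg]
  rw [sub_eq_iff_eq_add', sub_eq_iff_eq_add', ← sub_eq_add_neg]

/-- Otherwise `c`, of degree 1 over `K`, would be a zero at level `m + 1`, where degrees are `2 ^ (m
+ 1)`. -/
theorem radical_ne_zero {m : ℕ} {x : AlgebraicClosure K} (hx : x ∈ level θ m) :
    radical θ c m x ≠ 0 := by
  intro h0
  have h1 : aeval (algebraMap K (AlgebraicClosure K) c) (θ m) = x := by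
    rw [h.aeval_eq_iff, h0, sub_self]
  have h2 : algebraMap K (AlgebraicClosure K) c ∈ level θ (m + 1) := by
    rw [h.mem_level_succ, h1]; exact hx
  have h3 := h.natDegree_minpoly h2
  rw [minpoly.eq_X_sub_C, natDegree_X_sub_C] at h3
  have := Nat.one_lt_two_pow (Nat.succ_ne_zero m)
  omega

theorem exists_algEquiv {m : ℕ} {x y : AlgebraicClosure K} (hx : x ∈ level θ m)
    (hy : y ∈ level θ m) :
    ∃ σ : AlgebraicClosure K ≃ₐ[K] AlgebraicClosure K, σ x = y := by
  rw [← isConjRoot_iff_exists_algEquiv, IsConjRoot,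
    ← minpoly.eq_of_irreducible (h.irreducible m) (h.mem_level.1 hx),
    ← minpoly.eq_of_irreducible (h.irreducible m) (h.mem_level.1 hy)]

theorem map_mem_level {m : ℕ} {x : AlgebraicClosure K} (hx : x ∈ level θ m)
    (σ : AlgebraicClosure K ≃ₐ[K] AlgebraicClosure K) : σ x ∈ level θ m := by
  rw [h.mem_level] at hx ⊢
  exact (aeval_algHom_apply σ.toAlgHom x _).trans ((congrArg σ hx).trans (map_zero σ))

/-- An inclusion suffices, since being unramified passes to subfields (`IsUnramifiedAt.mono`). -/
theorem levelField_succ_le (m : ℕ) :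
    levelField θ (m + 1) ≤
      levelField θ m ⊔ IntermediateField.adjoin K (radical θ c m '' level θ m) := by
  rw [levelField, IntermediateField.adjoin_le_iff]
  intro y hy
  have hx := h.mem_level_succ.1 hy
  have hr : radical θ c m (aeval y (θ m)) ∈
      levelField θ m ⊔ IntermediateField.adjoin K (radical θ c m '' level θ m) :=
    (le_sup_right : _ ≤ levelField θ m ⊔ _)
      (IntermediateField.subset_adjoin K _ ⟨_, hx, rfl⟩)
  rcases h.aeval_eq_iff_or.1 (rfl : aeval y (θ m) = _) with e | e <;> rw [SetLike.mem_coe, e]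
  · exact add_mem (algebraMap_mem _ _) hr
  · exact sub_mem (algebraMap_mem _ _) hr

end IsIrreducibleSequence

end Quadratic

/-! ### Extension of valuations and ramification in towers of square roots. -/

section Valuation

variable {K : Type u} [Field K]

/-- A valuation ring of `L` dominating the image of that of `v` exists. Domination keeps nonunits
nonunits, so value 1 is both preserved and reflected. The value groups differ, hence the comparison
by equality of values. -/
theorem exists_valuation_extension {Γ : Type*} [LinearOrderedCommGroupWithZero Γ]
    (v : Valuation K Γ) (L : Type*) [Field L] [Algebra K L] :
    ∃ B : ValuationSubring L, (∀ x : K, v x ≤ 1 → B.valuation (algebraMap K L x) ≤ 1) ∧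
      ∀ x y : K, B.valuation (algebraMap K L x) = B.valuation (algebraMap K L y) ↔
        v x = v y := by
  obtain ⟨B, hB⟩ := (LocalSubring.map (algebraMap K L)
    v.valuationSubring.toLocalSubring).exists_le_valuationSubring
  have hle : ∀ x, v x ≤ 1 → B.valuation (algebraMap K L x) ≤ 1 := fun x hx =>
    (B.valuation_le_one_iff _).2 (hB.1 ⟨x, hx, rfl⟩)
  have hunit : ∀ x, v x = 1 → B.valuation (algebraMap K L x) = 1 := by
    intro x hx
    refine le_antisymm (hle x hx.le) ?_
    have h2 := hle x⁻¹ (by rw [map_inv₀, hx, inv_one])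
    have h0 : x ≠ 0 := by rintro rfl; simp at hx
    rw [map_inv₀, map_inv₀, inv_le_one₀ ] at h2
    · exact h2
    · simpa [zero_lt_iff] using h0
  have hone : ∀ x, B.valuation (algebraMap K L x) = 1 → v x = 1 := by
    intro x hx
    have h0 : x ≠ 0 := by rintro rfl; simp at hx
    rcases lt_trichotomy (v x) 1 with hlt | heq | hgt
    · exfalso
      have hmem : algebraMap K L x ∈ (LocalSubring.map (algebraMap K L)
          v.valuationSubring.toLocalSubring).toSubring := ⟨x, hlt.le, rfl⟩
      have hu : IsUnit (Subring.inclusion hB.1 ⟨algebraMap K L x, hmem⟩) :=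
        (B.valuation_eq_one_iff ⟨algebraMap K L x, hB.1 hmem⟩).2 hx
      obtain ⟨⟨z, w, hw, rfl⟩, hz⟩ := isUnit_iff_exists_inv.1 (hB.2.1 _ hu)
      have hz' : algebraMap K L x * algebraMap K L w = 1 := congrArg Subtype.val hz
      rw [← map_mul, ← map_one (algebraMap K L)] at hz'
      have h3 : v x * v w = 1 := by
        rw [← map_mul, (algebraMap K L).injective hz', map_one]
      have h4 : v w ≤ 1 := hw
      have : v x * v w < 1 := mul_lt_one_of_lt_of_le hlt h4
      exact this.ne h3
    · exact heq
    · exfalso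
      have hlt : v x⁻¹ < 1 := by
        rw [map_inv₀]; exact inv_lt_one_of_one_lt₀ hgt
      have hmem : algebraMap K L x⁻¹ ∈ (LocalSubring.map (algebraMap K L)
          v.valuationSubring.toLocalSubring).toSubring := ⟨x⁻¹, hlt.le, rfl⟩
      have hu : IsUnit (Subring.inclusion hB.1 ⟨algebraMap K L x⁻¹, hmem⟩) :=
        (B.valuation_eq_one_iff ⟨algebraMap K L x⁻¹, hB.1 hmem⟩).2
          (by simp only [map_inv₀, hx, inv_one])
      obtain ⟨⟨z, w, hw, rfl⟩, hz⟩ := isUnit_iff_exists_inv.1 (hB.2.1 _ hu)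
      have hz' : algebraMap K L x⁻¹ * algebraMap K L w = 1 := congrArg Subtype.val hz
      rw [← map_mul, ← map_one (algebraMap K L)] at hz'
      have h3 : v x⁻¹ * v w = 1 := by
        rw [← map_mul, (algebraMap K L).injective hz', map_one]
      have h4 : v w ≤ 1 := hw
      have : v x⁻¹ * v w < 1 := mul_lt_one_of_lt_of_le hlt h4
      exact this.ne h3
  refine ⟨B, hle, fun x y => ?_⟩
  by_cases hy : y = 0
  · simp [hy]
  have hv : v y ≠ 0 := by simpa using hy
  have hw : B.valuation (algebraMap K L y) ≠ 0 := by simpa using hy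
  rw [← div_eq_one_iff_eq hv, ← div_eq_one_iff_eq hw, ← map_div₀, ← map_div₀, ← map_div₀]
  exact ⟨hone _, hunit _⟩

variable {L : Type*} [Field L] [Algebra K L] {Γ : Type*} [LinearOrderedCommGroupWithZero Γ]

/-- Every value of `W` on `F` is already a value at an element of `K`. -/
def IsUnramifiedAt (W : Valuation L Γ) (F : IntermediateField K L) : Prop :=
  ∀ z ∈ F, ∃ x : K, W z = W (algebraMap K L x)

theorem IsUnramifiedAt.mono {W : Valuation L Γ} {F E : IntermediateField K L}
    (h : IsUnramifiedAt W F) (hE : E ≤ F) : IsUnramifiedAt W E := fun z hz => h z (hE hz)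

theorem isUnramifiedAt_bot (W : Valuation L Γ) :
    IsUnramifiedAt W (⊥ : IntermediateField K L) := by
  intro z hz
  obtain ⟨x, rfl⟩ := IntermediateField.mem_bot.1 hz
  exact ⟨x, rfl⟩

/-- Over an algebraic extension the adjoined field is the adjoined algebra, so only sums and
products need checking, not inverses. -/
theorem mem_sup_adjoin_sqrt [Algebra.IsAlgebraic K L] {F : IntermediateField K L} {s : L}
    (hs : s ^ 2 ∈ F) {z : L} (hz : z ∈ F ⊔ IntermediateField.adjoin K {s}) :
    ∃ x ∈ F, ∃ y ∈ F, z = x + y * s := by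
  have e : F ⊔ IntermediateField.adjoin K {s} = IntermediateField.adjoin K (F ∪ {s}) := by
    rw [IntermediateField.adjoin_union, IntermediateField.adjoin_self]
  rw [e, ← IntermediateField.mem_toSubalgebra,
    IntermediateField.adjoin_toSubalgebra_of_isAlgebraic
      fun x _ => Algebra.IsAlgebraic.isAlgebraic x] at hz
  induction hz using Algebra.adjoin_induction with
  | mem x hx =>
    rcases hx with hx | rfl
    · exact ⟨x, hx, 0, zero_mem _, by ring⟩
    · exact ⟨0, zero_mem _, 1, one_mem _, by ring⟩
  | algebraMap r => exact ⟨_, F.algebraMap_mem r, 0, zero_mem _, by ring⟩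
  | add a b _ _ ha hb =>
    obtain ⟨x, hx, y, hy, rfl⟩ := ha
    obtain ⟨x', hx', y', hy', rfl⟩ := hb
    exact ⟨_, add_mem hx hx', _, add_mem hy hy', by ring⟩
  | mul a b _ _ ha hb =>
    obtain ⟨x, hx, y, hy, rfl⟩ := ha
    obtain ⟨x', hx', y', hy', rfl⟩ := hb
    exact ⟨x * x' + y * y' * s ^ 2, add_mem (mul_mem hx hx') (mul_mem (mul_mem hy hy') hs),
      x * y' + x' * y, add_mem (mul_mem hx hy') (mul_mem hx' hy), by ring⟩

/-- For `z = x + y * s`, either `z` has the larger of the values of `x` and `y`, or `x - y * s`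
does, and then `z` has the value of an element of `F` obtained from the norm `x ^ 2 - y ^ 2 * s ^
2`. It does not matter whether `s` already lies in `F`. -/
theorem IsUnramifiedAt.sup_adjoin_sqrt [Algebra.IsAlgebraic K L] {W : Valuation L Γ}
    {F : IntermediateField K L} (h : IsUnramifiedAt W F) (h2 : W 2 = 1) {s : L} (hs : s ^ 2 ∈ F)
    (hs1 : W s = 1) : IsUnramifiedAt W (F ⊔ IntermediateField.adjoin K {s}) := by
  intro z hz
  obtain ⟨x, hx, y, hy, rfl⟩ := mem_sup_adjoin_sqrt hs hz
  obtain ⟨m, hm, hxm, hym, hmax⟩ : ∃ m ∈ F, W x ≤ W m ∧ W y ≤ W m ∧ (W m ≤ W x ∨ W m ≤ W y) := by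
    rcases le_total (W x) (W y) with hxy | hxy
    · exact ⟨y, hy, hxy, le_rfl, Or.inr le_rfl⟩
    · exact ⟨x, hx, le_rfl, hxy, Or.inl le_rfl⟩
  have hys : W (y * s) = W y := by rw [map_mul, hs1, mul_one]
  have h1 : W (x + y * s) ≤ W m := W.map_add_le hxm (hys.trans_le hym)
  have h1' : W (x - y * s) ≤ W m := W.map_sub_le hxm (hys.trans_le hym)
  rcases h1.eq_or_lt with heq | hlt
  · rw [heq]; exact h m hm
  -- If both `x + y * s` and `x - y * s` were smaller than `m`, so would be `2 * x` and `2 * (y *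
  -- s)`, hence `x` and `y`.
  have hconj : W (x - y * s) = W m := by
    refine h1'.eq_or_lt.resolve_right fun hlt' => ?_
    rcases hmax with hmx | hmy
    · have : W (2 * x) < W m := by
        rw [show 2 * x = (x + y * s) + (x - y * s) by ring]
        exact W.map_add_lt hlt hlt'
      rw [map_mul, h2, one_mul] at this
      exact absurd hmx this.not_ge
    · have : W (2 * (y * s)) < W m := by
        rw [show 2 * (y * s) = (x + y * s) - (x - y * s) by ring]
        exact (W.map_sub _ _).trans_lt (max_lt hlt hlt')
      rw [map_mul, h2, one_mul, hys] at this
      exact absurd hmy this.not_ge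
  have hm0 : W m ≠ 0 := (zero_le.trans_lt hlt).ne'
  obtain ⟨a, ha⟩ := h ((x ^ 2 - y ^ 2 * s ^ 2) / m)
    (div_mem (sub_mem (pow_mem hx 2) (mul_mem (pow_mem hy 2) hs)) hm)
  refine ⟨a, ?_⟩
  rw [← ha, map_div₀, show x ^ 2 - y ^ 2 * s ^ 2 = (x + y * s) * (x - y * s) by ring, map_mul,
    hconj, mul_div_cancel_right₀ _ hm0]

theorem IsUnramifiedAt.sup_adjoin_finite [Algebra.IsAlgebraic K L] {W : Valuation L Γ}
    {F : IntermediateField K L} (h : IsUnramifiedAt W F) (h2 : W 2 = 1) {T : Set L}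
    (hT : T.Finite) (hs : ∀ s ∈ T, s ^ 2 ∈ F) (hs1 : ∀ s ∈ T, W s = 1) :
    IsUnramifiedAt W (F ⊔ IntermediateField.adjoin K T) := by
  induction T, hT using Set.Finite.induction_on with
  | empty => simpa using h
  | @insert a T _ _ ih =>
    rw [Set.insert_eq, Set.union_comm, IntermediateField.adjoin_union, ← sup_assoc]
    have := ih (fun s hs' => hs s (Set.mem_insert_of_mem _ hs'))
      (fun s hs' => hs1 s (Set.mem_insert_of_mem _ hs'))
    exact this.sup_adjoin_sqrt h2
      ((le_sup_left : F ≤ _) (hs a (Set.mem_insert _ _))) (hs1 a (Set.mem_insert _ _))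

end Valuation

/-! ### Good primes are unramified in the level fields. -/

section LevelValuation

variable {K : Type u} [Field K]

theorem aeval_eval_rightIter (θ : ℕ → K[X]) (c : K) (m : ℕ) :
    aeval (algebraMap K (AlgebraicClosure K) ((θ m).eval c)) (rightIter θ m) =
      algebraMap K _ ((rightIter θ (m + 1)).eval c) := by
  rw [aeval_algebraMap_apply, rightIter, eval_comp, coe_aeval_eq_eval]

namespace IsIrreducibleSequence

variable {θ : ℕ → K[X]} {c : K} (h : IsIrreducibleSequence θ c)
  {Γ : Type*} [LinearOrderedCommGroupWithZero Γ] {W : Valuation (AlgebraicClosure K) Γ} {n : ℕ}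
include h

theorem valuation_le_one_of_mem_level (hc : W (algebraMap K _ c) ≤ 1)
    (hb : ∀ i, W (algebraMap K _ ((θ i).eval c)) ≤ 1)
    (ha : ∀ i < n, W (algebraMap K _ (θ i).leadingCoeff) = 1) {m : ℕ} (hm : m ≤ n)
    {x : AlgebraicClosure K} (hx : x ∈ level θ m) : W x ≤ 1 := by
  induction m generalizing x with
  | zero =>
    have : x = 0 := by simpa [rightIter] using h.mem_level.1 hx
    simp [this]
  | succ m ih =>
    have hy := ih (by omega) (h.mem_level_succ.1 hx)
    have hr : W (radical θ c m (aeval x (θ m))) ≤ 1 := by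
      rw [← pow_le_one_iff two_ne_zero, ← map_pow, radical_sq, map_div₀, ha m (by omega), div_one]
      exact W.map_sub_le hy (hb m)
    rcases h.aeval_eq_iff_or.1 (rfl : aeval x (θ m) = _) with e | e <;> rw [e]
    · exact W.map_add_le hc hr
    · exact W.map_sub_le hc hr

/-- For a polynomial `f` with integral coefficients, `f x - f y` is an integral multiple of `x - y`.
-/
theorem valuation_aeval_sub_le (hc : W (algebraMap K _ c) ≤ 1)
    (hb : ∀ i, W (algebraMap K _ ((θ i).eval c)) ≤ 1)
    (ha : ∀ i < n, W (algebraMap K _ (θ i).leadingCoeff) = 1) {m : ℕ} (hm : m ≤ n)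
    {x y : AlgebraicClosure K} (hx : W x ≤ 1) (hy : W y ≤ 1) :
    W (aeval x (rightIter θ m) - aeval y (rightIter θ m)) ≤ W (x - y) := by
  induction m generalizing x y with
  | zero => simp [rightIter]
  | succ m ih =>
    have key : ∀ z : AlgebraicClosure K, W z ≤ 1 → W (aeval z (θ m)) ≤ 1 := fun z hz => by
      rw [aeval_quadratic (h.natDegree_eq m) (h.critical m)]
      refine W.map_add_le ?_ (hb m)
      rw [map_mul, ha m (by omega), one_mul, map_pow]
      exact pow_le_one₀ zero_le (W.map_sub_le hz hc)
    rw [aeval_rightIter_succ, aeval_rightIter_succ]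
    refine (ih (by omega) (key x hx) (key y hy)).trans ?_
    rw [aeval_quadratic (h.natDegree_eq m) (h.critical m),
      aeval_quadratic (h.natDegree_eq m) (h.critical m)]
    set a := algebraMap K (AlgebraicClosure K) (θ m).leadingCoeff
    set d := algebraMap K (AlgebraicClosure K) c
    rw [show a * (x - d) ^ 2 + algebraMap K _ ((θ m).eval c) -
      (a * (y - d) ^ 2 + algebraMap K _ ((θ m).eval c)) = a * ((x - y) * ((x - d) + (y - d))) by
        ring, map_mul, ha m (by omega), one_mul, map_mul]
    exact mul_le_of_le_one_right zero_le
      (W.map_add_le (W.map_sub_le hx hc) (W.map_sub_le hy hc))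

/-- With `b = (θ m).eval c`, the iterate of index `m` vanishes at `x` and takes at `b` the unit
value of the next iterate at `c`. As iterates do not expand distances, `x - b` is a unit. -/
theorem valuation_radical_eq_one (hc : W (algebraMap K _ c) ≤ 1)
    (hb : ∀ i, W (algebraMap K _ ((θ i).eval c)) ≤ 1)
    (ha : ∀ i < n, W (algebraMap K _ (θ i).leadingCoeff) = 1) {m : ℕ} (hm : m < n)
    (hγ : W (algebraMap K _ ((rightIter θ (m + 1)).eval c)) = 1)
    {x : AlgebraicClosure K} (hx : x ∈ level θ m) : W (radical θ c m x) = 1 := by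
  have hx1 := h.valuation_le_one_of_mem_level hc hb ha hm.le hx
  have h1 : W (x - algebraMap K _ ((θ m).eval c)) = 1 := by
    refine le_antisymm (W.map_sub_le hx1 (hb m)) ?_
    have := h.valuation_aeval_sub_le hc hb ha hm.le (hb m) hx1
    rwa [h.mem_level.1 hx, sub_zero, aeval_eval_rightIter, hγ, W.map_sub_swap] at this
  rw [← pow_eq_one_iff_of_nonneg zero_le two_ne_zero, ← map_pow, radical_sq, map_div₀, h1,
    ha m hm, div_one]

theorem isUnramifiedAt_levelField (h2 : W 2 = 1) (hc : W (algebraMap K _ c) ≤ 1)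
    (hb : ∀ i, W (algebraMap K _ ((θ i).eval c)) ≤ 1)
    (ha : ∀ i < n, W (algebraMap K _ (θ i).leadingCoeff) = 1)
    (hγ : ∀ m < n, W (algebraMap K _ ((rightIter θ (m + 1)).eval c)) = 1) {m : ℕ} (hm : m ≤ n) :
    IsUnramifiedAt W (levelField θ m) := by
  induction m with
  | zero =>
    refine (isUnramifiedAt_bot W).mono ?_
    rw [levelField, IntermediateField.adjoin_le_iff]
    intro x hx
    have : x = 0 := by simpa [rightIter] using h.mem_level.1 hx
    rw [this]
    exact zero_mem (⊥ : IntermediateField K (AlgebraicClosure K))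
  | succ m ih =>
    refine ((ih (by omega)).sup_adjoin_finite h2 ((rootSet_finite _ _).image _) ?_ ?_).mono
      (h.levelField_succ_le m)
    · rintro _ ⟨x, hx, rfl⟩
      rw [radical_sq]
      exact div_mem (sub_mem (IntermediateField.subset_adjoin K _ hx)
        (IntermediateField.algebraMap_mem _ _)) (IntermediateField.algebraMap_mem _ _)
    · rintro _ ⟨x, hx, rfl⟩
      exact h.valuation_radical_eq_one hc hb ha (by omega) (hγ m (by omega)) hx

theorem valuation_leadingCoeff_rightIter
    (ha : ∀ i < n, W (algebraMap K _ (θ i).leadingCoeff) = 1) {m : ℕ} (hm : m ≤ n) :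
    W (algebraMap K _ (rightIter θ m).leadingCoeff) = 1 := by
  induction m with
  | zero => simp [rightIter]
  | succ m ih =>
    rw [rightIter, leadingCoeff_comp (by rw [h.natDegree_eq]; exact two_ne_zero), map_mul, map_mul,
      ih (by omega), map_pow, map_pow, ha m (by omega), one_pow, one_mul]

theorem aeval_rightIter_eq_prod [CharZero K] (m : ℕ) (y : AlgebraicClosure K) :
    aeval y (rightIter θ m) =
      algebraMap K _ (rightIter θ m).leadingCoeff * ∏ x : level θ m, (y - x) := by
  have hnd : ((rightIter θ m).aroots (AlgebraicClosure K)).Nodup :=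
    nodup_roots ((h.irreducible m).separable.map)
  classical
  have hs : (level θ m).toFinset = ⟨_, hnd⟩ := by
    ext x
    simp [rootSet]
  rw [Splits.aeval_eq_prod_aroots (IsAlgClosed.splits _), Finset.prod_set_coe, hs]
  rfl

theorem valuation_prod_radical_sq [CharZero K]
    (ha : ∀ i < n + 1, W (algebraMap K _ (θ i).leadingCoeff) = 1) :
    W (∏ x : level θ n, radical θ c n x) ^ 2 =
      W (algebraMap K _ ((rightIter θ (n + 1)).eval c)) := by
  rw [← aeval_eval_rightIter, h.aeval_rightIter_eq_prod, map_mul,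
    h.valuation_leadingCoeff_rightIter ha n.le_succ, one_mul, map_prod, map_prod,
    ← Finset.prod_pow]
  refine Finset.prod_congr rfl fun x _ => ?_
  rw [← map_pow, radical_sq, map_div₀, ha n n.lt_succ_self, div_one, W.map_sub_swap]

/-- A prime that is good at `n + 1` obstructs the product of the radicals at level `n` from lying
in the `n`-th level field. -/
theorem prod_radical_notMem [CharZero K] {v : Valuation K ℤᵐ⁰} (hc : v c ≤ 1)
    (hb : ∀ i, v ((θ i).eval c) ≤ 1) (hv : IsGoodAt v θ c (n + 1)) :
    ∏ x : level θ n, radical θ c n x ∉ levelField θ n := by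
  intro hmem
  obtain ⟨B, hle, hiff⟩ := exists_valuation_extension v (AlgebraicClosure K)
  obtain ⟨h2, ha, hγ, j, hj, hvj⟩ := hv
  have hone : ∀ x, v x = 1 → B.valuation (algebraMap K (AlgebraicClosure K) x) = 1 :=
    fun x hx => by
      rw [← map_one B.valuation, ← map_one (algebraMap K (AlgebraicClosure K)), hiff, hx, map_one]
  have hun := h.isUnramifiedAt_levelField (n := n) (by rw [← map_ofNat (algebraMap K (AlgebraicClosure K)) 2]; exact hone 2 h2) (hle c hc)
    (fun i => hle _ (hb i)) (fun i hi => hone _ (ha i (by omega)))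
    (fun m hm => hone _ (hγ (m + 1) (by omega) (by omega))) le_rfl
  obtain ⟨x, hx⟩ := hun _ hmem
  have h1 := h.valuation_prod_radical_sq (n := n) (W := B.valuation)
    (fun i hi => hone _ (ha i hi))
  -- Both sides now come from `K`, so the odd value of `v` would be twice an integer.
  rw [hx, ← map_pow, ← map_pow, hiff, map_pow, hvj] at h1
  have hx0 : v x ≠ 0 := by
    intro e
    rw [e, zero_pow two_ne_zero] at h1
    exact WithZero.exp_ne_zero h1.symm
  rw [← WithZero.exp_log hx0, ← WithZero.exp_nsmul, WithZero.exp_inj] at h1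
  obtain ⟨i, rfl⟩ := hj
  simp only [nsmul_eq_mul, Nat.cast_ofNat] at h1
  omega

end IsIrreducibleSequence

end LevelValuation

/-! ### Sign changes of the radicals over a level field. -/

section Kummer

variable {K : Type u} [Field K]

/-- The action of the absolute Galois group on the `n`-th level. -/
def levelPerm (θ : ℕ → K[X]) (n : ℕ) :
    (AlgebraicClosure K ≃ₐ[K] AlgebraicClosure K) →* Equiv.Perm (level θ n) where
  toFun σ :=
    { toFun := fun x => ⟨σ x, rootSet_mapsTo σ.toAlgHom x.2⟩
      invFun := fun x => ⟨σ.symm x, rootSet_mapsTo σ.symm.toAlgHom x.2⟩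
      left_inv := fun x => Subtype.ext (σ.symm_apply_apply x)
      right_inv := fun x => Subtype.ext (σ.apply_symm_apply x) }
  map_one' := rfl
  map_mul' _ _ := rfl

@[simp]
theorem coe_levelPerm (θ : ℕ → K[X]) (n : ℕ) (σ : AlgebraicClosure K ≃ₐ[K] AlgebraicClosure K)
    (x : level θ n) : (levelPerm θ n σ x : AlgebraicClosure K) = σ x := rfl

theorem mem_fixingSubgroup_levelField {θ : ℕ → K[X]} {n : ℕ}
    {τ : AlgebraicClosure K ≃ₐ[K] AlgebraicClosure K} :
    τ ∈ (levelField θ n).fixingSubgroup ↔ ∀ x ∈ level θ n, τ x = x := by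
  rw [IntermediateField.mem_fixingSubgroup_iff]
  refine ⟨fun h x hx => h x (IntermediateField.subset_adjoin K _ hx), fun h x hx => ?_⟩
  induction hx using IntermediateField.adjoin_induction with
  | mem x hx => exact h x hx
  | algebraMap x => exact τ.commutes x
  | add x y _ _ hx hy => rw [map_add, hx, hy]
  | inv x _ hx => rw [map_inv₀, hx]
  | mul x y _ _ hx hy => rw [map_mul, hx, hy]

open Classical in
/-- The indicator of whether `τ` moves the radical attached to a vertex of level `n`. -/
def flip (θ : ℕ → K[X]) (c : K) (n : ℕ) (τ : AlgebraicClosure K ≃ₐ[K] AlgebraicClosure K)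
    (x : level θ n) : ZMod 2 :=
  if τ (radical θ c n x) = radical θ c n x then 0 else 1

/-- The sign attached to an element of `ZMod 2`. -/
def parity (R : Type*) [CommRing R] (a : ZMod 2) : R := if a = 0 then 1 else -1

theorem parity_add (R : Type*) [CommRing R] (a b : ZMod 2) :
    parity R (a + b) = parity R a * parity R b := by
  have : ∀ a : ZMod 2, a = 0 ∨ a = 1 := by decide
  rcases this a with rfl | rfl <;> rcases this b with rfl | rfl <;>
    simp [parity, show (1 + 1 : ZMod 2) = 0 from rfl]

theorem parity_sum (R : Type*) [CommRing R] {ι : Type*} (s : Finset ι) (f : ι → ZMod 2) :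
    parity R (∑ i ∈ s, f i) = ∏ i ∈ s, parity R (f i) := by
  classical
  induction s using Finset.induction_on with
  | empty => simp [parity]
  | insert a s ha ih => rw [Finset.sum_insert ha, Finset.prod_insert ha, parity_add, ih]

theorem parity_injective (R : Type*) [CommRing R] [Nontrivial R] [NeZero (2 : R)]
    [NoZeroDivisors R] : Function.Injective (parity R) := by
  have h2 : (1 : R) ≠ -1 := fun e => NeZero.ne (2 : R) (by linear_combination e)
  have : ∀ a : ZMod 2, a = 0 ∨ a = 1 := by decide
  intro a b e
  rcases this a with rfl | rfl <;> rcases this b with rfl | rfl <;>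
    simp_all [parity, eq_comm]

theorem map_radical_eq_parity {θ : ℕ → K[X]} {n : ℕ} (c : K)
    {τ : AlgebraicClosure K ≃ₐ[K] AlgebraicClosure K}
    (hτ : τ ∈ (levelField θ n).fixingSubgroup) (x : level θ n) :
    τ (radical θ c n x) = parity _ (flip θ c n τ x) * radical θ c n x := by
  have hx := mem_fixingSubgroup_levelField.1 hτ x x.2
  rw [flip]
  split_ifs with h0
  · simp [parity, h0]
  · have := map_radical θ c n x τ
    rw [hx] at this
    simp [parity, this.resolve_left h0]

/-- The sign ambiguity in `map_radical` is harmless: `τ` fixes an element exactly when it fixes its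
negative. -/
theorem flip_conj (θ : ℕ → K[X]) (c : K) (n : ℕ)
    (σ τ : AlgebraicClosure K ≃ₐ[K] AlgebraicClosure K) (x : level θ n) :
    flip θ c n (σ⁻¹ * τ * σ) x = flip θ c n τ (levelPerm θ n σ x) := by
  unfold flip
  congr 1
  have e : (σ⁻¹ * τ * σ) (radical θ c n x) = radical θ c n x ↔
      τ (σ (radical θ c n x)) = σ (radical θ c n x) := by
    change σ.symm (τ (σ (radical θ c n x))) = _ ↔ _
    rw [AlgEquiv.symm_apply_eq]
  rw [e, coe_levelPerm]
  rcases map_radical θ c n x σ with e | e <;> simp [e]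

namespace IsIrreducibleSequence

variable {θ : ℕ → K[X]} {c : K} (h : IsIrreducibleSequence θ c) {n : ℕ}
include h

theorem flip_mul [CharZero K] {τ τ' : AlgebraicClosure K ≃ₐ[K] AlgebraicClosure K}
    (hτ : τ ∈ (levelField θ n).fixingSubgroup) (hτ' : τ' ∈ (levelField θ n).fixingSubgroup)
    (x : level θ n) : flip θ c n (τ * τ') x = flip θ c n τ x + flip θ c n τ' x := by
  have := map_radical_eq_parity c (mul_mem hτ hτ') x
  rw [AlgEquiv.mul_apply, map_radical_eq_parity c hτ', map_mul, map_radical_eq_parity c hτ,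
    ← mul_assoc] at this
  have hp : τ (parity _ (flip θ c n τ' x)) = parity _ (flip θ c n τ' x) := by
    rw [parity]; split_ifs <;> simp
  have := mul_right_cancel₀ (h.radical_ne_zero x.2) this
  rw [hp, ← parity_add] at this
  rw [← parity_injective _ this, add_comm]

theorem conj_mem {τ : AlgebraicClosure K ≃ₐ[K] AlgebraicClosure K}
    (hτ : τ ∈ (levelField θ n).fixingSubgroup)
    (σ : AlgebraicClosure K ≃ₐ[K] AlgebraicClosure K) :
    σ⁻¹ * τ * σ ∈ (levelField θ n).fixingSubgroup := by
  rw [mem_fixingSubgroup_levelField] at hτ ⊢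
  intro x hx
  change σ.symm (τ (σ x)) = x
  rw [hτ _ (h.map_mem_level hx σ), σ.symm_apply_apply]

/-- By induction `σ ^ 2 ^ n` fixes the parent of a vertex of level `n + 1`, so it fixes the vertex
or sends it to its sibling `2c - x`; its square fixes it. -/
theorem pow_two_pow_apply (σ : AlgebraicClosure K ≃ₐ[K] AlgebraicClosure K)
    {x : AlgebraicClosure K} (hx : x ∈ level θ n) : (σ ^ 2 ^ n) x = x := by
  induction n generalizing x with
  | zero =>
    have : x = 0 := by simpa [rightIter] using h.mem_level.1 hx
    rw [this, map_zero]
  | succ n ih =>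
    rw [pow_succ, pow_mul, pow_two, AlgEquiv.mul_apply]
    have hy := ih (h.mem_level_succ.1 hx)
    set τ := σ ^ 2 ^ n
    have h1 : aeval (τ x) (θ n) = aeval x (θ n) :=
      (aeval_algHom_apply τ.toAlgHom x _).trans hy
    rw [h.aeval_eq_iff, ← h.aeval_eq_iff.1 (rfl : aeval x (θ n) = _), sq_eq_sq_iff_eq_or_eq_neg]
      at h1
    rcases h1 with h1 | h1
    · have h1 : τ x = x := by linear_combination h1
      rw [h1, h1]
    · have h1 : τ x = algebraMap K _ c + algebraMap K _ c - x := by linear_combination h1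
      rw [h1, map_sub, map_add, AlgEquiv.commutes, h1]
      ring

theorem isPGroup_range_levelPerm : IsPGroup 2 (levelPerm θ n).range := by
  rintro ⟨_, σ, rfl⟩
  refine ⟨n, Subtype.ext ?_⟩
  change levelPerm θ n σ ^ 2 ^ n = 1
  rw [← map_pow]
  exact Equiv.ext fun x => Subtype.ext (h.pow_two_pow_apply σ x.2)

/-- The sign changes of the radicals at level `n` induced by automorphisms over the `n`-th level
field. -/
def flipSubmodule [CharZero K] (n : ℕ) : Submodule (ZMod 2) (level θ n → ZMod 2) where
  carrier := {f | ∃ τ ∈ (levelField θ n).fixingSubgroup, flip θ c n τ = f}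
  add_mem' := by
    rintro _ _ ⟨τ, hτ, rfl⟩ ⟨τ', hτ', rfl⟩
    exact ⟨τ * τ', mul_mem hτ hτ', funext (h.flip_mul hτ hτ')⟩
  zero_mem' := ⟨1, one_mem _, funext fun x => by simp [flip]⟩
  smul_mem' := by
    rintro a _ ⟨τ, hτ, rfl⟩
    have : a = 0 ∨ a = 1 := by revert a; decide
    rcases this with rfl | rfl
    · exact ⟨1, one_mem _, funext fun x => by simp [flip]⟩
    · exact ⟨τ, hτ, (one_smul _ _).symm⟩

/-- The linear relations satisfied by all the sign changes. -/
def relations [CharZero K] (n : ℕ) : AddSubgroup (level θ n → ZMod 2) where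
  carrier := {f | ∀ w ∈ h.flipSubmodule n, f ⬝ᵥ w = 0}
  add_mem' := fun ha hb w hw => by rw [add_dotProduct, ha w hw, hb w hw, add_zero]
  zero_mem' := fun w _ => zero_dotProduct w
  neg_mem' := fun ha w hw => by rw [neg_dotProduct, ha w hw, neg_zero]

theorem comp_levelPerm_mem_flipSubmodule [CharZero K] {w : level θ n → ZMod 2}
    (hw : w ∈ h.flipSubmodule n) (σ : AlgebraicClosure K ≃ₐ[K] AlgebraicClosure K) :
    w ∘ levelPerm θ n σ ∈ h.flipSubmodule n := by
  obtain ⟨τ, hτ, rfl⟩ := hw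
  exact ⟨σ⁻¹ * τ * σ, h.conj_mem hτ σ, funext (flip_conj θ c n σ τ)⟩

theorem comp_mem_relations [CharZero K] {f : level θ n → ZMod 2}
    (hf : f ∈ h.relations n) (p : (levelPerm θ n).range) :
    f ∘ (p⁻¹ : (levelPerm θ n).range).1 ∈ h.relations n := by
  obtain ⟨_, σ, rfl⟩ := p
  intro w hw
  rw [← hf _ (h.comp_levelPerm_mem_flipSubmodule hw σ)]
  change ∑ x, _ = ∑ x, _
  rw [← Equiv.sum_comp (levelPerm θ n σ)]
  simp

/-- The permutation action of the Galois group of level `n` on the relations. -/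
@[reducible]
def relationsAction [CharZero K] (n : ℕ) :
    MulAction (levelPerm θ n).range (h.relations n) where
  smul p f := ⟨f.1 ∘ (p⁻¹ : (levelPerm θ n).range).1, h.comp_mem_relations f.2 p⟩
  one_smul _ := rfl
  mul_smul p q f := Subtype.ext <| by
    change f.1 ∘ ((p * q)⁻¹ : (levelPerm θ n).range).1 = _
    rw [mul_inv_rev]
    rfl

/-- A 2-group acting on a finite set of even cardinality with one fixed point has a second one; here
the first is the zero relation. -/
theorem relations_eq_bot [CharZero K]
    (hnot : ∏ x : level θ n, radical θ c n x ∉ levelField θ n) : h.relations n = ⊥ := by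
  by_contra hbot
  obtain ⟨⟨f, hf⟩, hf0⟩ := AddSubgroup.ne_bot_iff_exists_ne_zero.1 hbot
  let _ := h.relationsAction n
  have hcard : 2 ∣ Nat.card (h.relations n) := by
    have h2 : addOrderOf (⟨f, hf⟩ : h.relations n) = 2 := by
      refine addOrderOf_eq_prime (Subtype.ext ?_) hf0
      change 2 • f = 0
      funext x
      rw [Pi.smul_apply, two_nsmul, CharTwo.add_self_eq_zero, Pi.zero_apply]
    have := addOrderOf_dvd_natCard (⟨f, hf⟩ : h.relations n)
    rwa [h2] at this
  have h0 : (0 : h.relations n) ∈ MulAction.fixedPoints (levelPerm θ n).range _ :=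
    fun p => Subtype.ext (funext fun x => by
      change (0 : level θ n → ZMod 2) _ = 0
      rfl)
  obtain ⟨g, hg, hg0⟩ :=
    h.isPGroup_range_levelPerm.exists_fixed_point_of_prime_dvd_card_of_fixed_point
      (h.relations n) hcard h0
  have hginv : ∀ (σ : AlgebraicClosure K ≃ₐ[K] AlgebraicClosure K) x,
      g.1 (levelPerm θ n σ x) = g.1 x := by
    intro σ x
    have := congrArg Subtype.val (hg (⟨levelPerm θ n σ, σ, rfl⟩)⁻¹)
    exact congrFun this x
  obtain ⟨x₀, hx₀⟩ : ∃ x, g.1 x ≠ 0 := by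
    by_contra! hall
    exact hg0 (Subtype.ext (funext fun x => (hall x).symm))
  -- The group is transitive on the level, so an invariant nonzero relation is constant.
  have hg1 : ∀ x, g.1 x = 1 := by
    intro x
    obtain ⟨σ, hσ⟩ := h.exists_algEquiv x₀.2 x.2
    have e : levelPerm θ n σ x₀ = x := Subtype.ext hσ
    rw [← e, hginv]
    have : ∀ a : ZMod 2, a ≠ 0 → a = 1 := by decide
    exact this _ hx₀
  -- By the all-ones relation, any `τ` over the level field changes an even number of signs, hence
  -- fixes the product; the Galois correspondence puts the product in the field.
  refine hnot ?_
  rw [← InfiniteGalois.fixedField_fixingSubgroup (levelField θ n)]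
  rintro ⟨τ, hτ⟩
  have hsum : ∑ x, flip θ c n τ x = 0 := by
    rw [← g.2 _ ⟨τ, hτ, rfl⟩]
    exact Finset.sum_congr rfl fun x _ => by rw [hg1, one_mul]
  change τ (∏ x : level θ n, radical θ c n x) = _
  rw [map_prod, Finset.prod_congr rfl fun x _ => map_radical_eq_parity c hτ x,
    Finset.prod_mul_distrib, ← parity_sum, hsum]
  simp [parity]

/-- Every pattern of sign changes of the radicals at level `n` is realized by an automorphism over
the `n`-th level field. -/
theorem exists_flip_eq [CharZero K]
    (hnot : ∏ x : level θ n, radical θ c n x ∉ levelField θ n) (e : level θ n → ZMod 2) :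
    ∃ τ ∈ (levelField θ n).fixingSubgroup, flip θ c n τ = e := by
  classical
  suffices htop : h.flipSubmodule n = ⊤ by
    have : e ∈ h.flipSubmodule n := htop ▸ Submodule.mem_top
    exact this
  by_contra hne
  -- A proper subspace is killed by a nonzero functional, whose coordinates form a nonzero relation.
  obtain ⟨g, hg0, hg⟩ := Submodule.exists_le_ker_of_lt_top _ (lt_top_iff_ne_top.2 hne)
  have hgsum : ∀ w, g w = (fun x => g (Pi.single x 1)) ⬝ᵥ w := by
    intro w
    conv_lhs => rw [pi_eq_sum_univ' w, map_sum]
    refine Finset.sum_congr rfl fun x _ => ?_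
    rw [map_smul, smul_eq_mul, mul_comm]
  have hmem : (fun x => g (Pi.single x 1)) ∈ h.relations n := fun w hw => by
    rw [← hgsum]; exact hg hw
  rw [h.relations_eq_bot hnot, AddSubgroup.mem_bot] at hmem
  refine hg0 (LinearMap.ext fun w => ?_)
  rw [hgsum, hmem, zero_dotProduct, LinearMap.zero_apply]

end IsIrreducibleSequence

end Kummer

/-! ### Tree automorphisms and their approximation by Galois elements. -/

section TreeAutomorphism

variable {K : Type u} [Field K] {θ : ℕ → K[X]} {c : K}

/-- A zero of the `m`-th right iterate, as a vertex of the tree. -/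
def toVertex {m : ℕ} {x : AlgebraicClosure K} (hx : x ∈ level θ m) : Vertex θ := ⟨x, m, hx⟩

/-- `σ` and `φ` act in the same way on level `n`. -/
def Agree (σ : AlgebraicClosure K ≃ₐ[K] AlgebraicClosure K)
    (φ : preimageTree θ ≃g preimageTree θ) (n : ℕ) : Prop :=
  ∀ α : Vertex θ, α.1 ∈ level θ n → (φ α).1 = σ α.1

theorem isClosed_setOf_apply_eq (x y : AlgebraicClosure K) :
    IsClosed {σ : AlgebraicClosure K ≃ₐ[K] AlgebraicClosure K | σ x = y} := by
  by_cases hne : ∃ σ₀ : AlgebraicClosure K ≃ₐ[K] AlgebraicClosure K, σ₀ x = y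
  · obtain ⟨σ₀, rfl⟩ := hne
    have h1 : IsClosed (MulAction.stabilizer (AlgebraicClosure K ≃ₐ[K] AlgebraicClosure K) x :
        Set (AlgebraicClosure K ≃ₐ[K] AlgebraicClosure K)) :=
      Subgroup.isClosed_of_isOpen _ (stabilizer_isOpen_of_isIntegral x)
    convert h1.preimage (continuous_const_mul σ₀⁻¹) using 1
    ext σ
    change _ ↔ σ₀.symm (σ x) = x
    rw [AlgEquiv.symm_apply_eq]
    rfl
  · convert isClosed_empty
    ext σ
    simpa using fun e => hne ⟨σ, e⟩

theorem isClosed_setOf_agree (φ : preimageTree θ ≃g preimageTree θ) (n : ℕ) :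
    IsClosed {σ | Agree σ φ n} := by
  simp only [Agree, Set.ofPred_forall]
  refine isClosed_iInter fun α => isClosed_iInter fun _ => ?_
  simpa only [eq_comm] using isClosed_setOf_apply_eq α.1 (φ α).1

instance normal_treeField (θ : ℕ → K[X]) : Normal K (treeField θ) := by
  have (n : ℕ) : Normal K (levelField θ n) :=
    have : IsSplittingField K (levelField θ n) (rightIter θ n) :=
      IntermediateField.adjoin_rootSet_isSplittingField
        (IsAlgClosed.splits ((rightIter θ n).map (algebraMap K (AlgebraicClosure K))))
    Normal.of_isSplittingField (rightIter θ n)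
  exact IntermediateField.normal_iSup K _ _

theorem arborealRep_injective (θ : ℕ → K[X]) : Function.Injective (arborealRep θ) := by
  rw [injective_iff_map_eq_one]
  intro s hs
  have hlift : ∀ x : treeField θ, s.liftNormal (AlgebraicClosure K) x = s x :=
    fun x => s.liftNormal_commutes (AlgebraicClosure K) x
  -- Phrasing the claim as an inclusion in a fixed field reduces it to the single levels of the
  -- supremum.
  have hfix : treeField θ ≤
      IntermediateField.fixedField (Subgroup.zpowers (s.liftNormal (AlgebraicClosure K))) := by
    refine iSup_le fun n => ?_
    rw [IntermediateField.le_iff_le, Subgroup.zpowers_le, mem_fixingSubgroup_levelField]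
    intro x hx
    have h1 := congrArg Subtype.val (DFunLike.congr_fun hs (toVertex hx))
    exact (hlift ⟨x, mem_treeField θ hx⟩).trans h1
  refine AlgEquiv.ext fun x => Subtype.ext ?_
  rw [← hlift]
  exact hfix x.2 ⟨_, Subgroup.mem_zpowers _⟩

theorem mem_range_arborealRep {φ : preimageTree θ ≃g preimageTree θ}
    {σ : AlgebraicClosure K ≃ₐ[K] AlgebraicClosure K} (h : ∀ n, Agree σ φ n) :
    φ ∈ (arborealRep θ).range := by
  refine ⟨σ.restrictNormal (treeField θ), RelIso.ext fun α => Subtype.ext ?_⟩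
  obtain ⟨n, hn⟩ := α.2
  rw [h n α hn]
  exact σ.restrictNormal_commutes (treeField θ) ⟨α.1, Vertex.mem θ α⟩

namespace IsIrreducibleSequence

variable (h : IsIrreducibleSequence θ c)
include h

theorem add_radical_mem {m : ℕ} {x : AlgebraicClosure K} (hx : x ∈ level θ m) :
    algebraMap K _ c + radical θ c m x ∈ level θ (m + 1) := by
  rw [h.mem_level_succ, h.aeval_eq_iff_or.2 (Or.inl rfl)]
  exact hx

theorem sub_radical_mem {m : ℕ} {x : AlgebraicClosure K} (hx : x ∈ level θ m) :
    algebraMap K _ c - radical θ c m x ∈ level θ (m + 1) := by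
  rw [h.mem_level_succ, h.aeval_eq_iff_or.2 (Or.inr rfl)]
  exact hx

theorem adj_of_child {m : ℕ} {α β : Vertex θ} (hβ : β.1 ∈ level θ (m + 1))
    (e : aeval β.1 (θ m) = α.1) : (preimageTree θ).Adj α β := by
  rw [preimageTree, SimpleGraph.fromRel_adj]
  refine ⟨?_, Or.inr ⟨m, hβ, e.symm⟩⟩
  rintro rfl
  have := h.mem_level_succ.1 hβ
  rw [e] at this
  have := h.level_unique this hβ
  omega

theorem child_or_parent_of_adj {m : ℕ} {α β : Vertex θ} (hα : α.1 ∈ level θ m)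
    (hadj : (preimageTree θ).Adj α β) :
    (β.1 ∈ level θ (m + 1) ∧ aeval β.1 (θ m) = α.1) ∨
      ∃ k, m = k + 1 ∧ β.1 = aeval α.1 (θ k) := by
  rw [preimageTree, SimpleGraph.fromRel_adj] at hadj
  rcases hadj.2 with ⟨k, hk, e⟩ | ⟨k, hk, e⟩
  · exact Or.inr ⟨k, h.level_unique hα hk, e⟩
  · have := h.mem_level_succ.1 hk
    rw [← e] at this
    obtain rfl := h.level_unique hα this
    exact Or.inl ⟨hk, e.symm⟩

/-- The root has only two neighbours, its children, while any other vertex has three: two children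
and a parent. -/
theorem map_level_zero [CharZero K] (φ : preimageTree θ ≃g preimageTree θ) {α : Vertex θ}
    (hα : α.1 ∈ level θ 0) : (φ α).1 ∈ level θ 0 := by
  obtain ⟨n, hn⟩ := (φ α).2
  rcases n with _ | m
  · exact hn
  exfalso
  have key : ∀ β, (preimageTree θ).Adj (φ α) β →
      (φ.symm β).1 = algebraMap K _ c + radical θ c 0 α.1 ∨
      (φ.symm β).1 = algebraMap K _ c - radical θ c 0 α.1 := by
    intro β hβ
    have hadj : (preimageTree θ).Adj α (φ.symm β) := by
      rw [← φ.map_adj_iff]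
      simpa using hβ
    rcases h.child_or_parent_of_adj hα hadj with ⟨_, e⟩ | ⟨k, hk, _⟩
    · exact h.aeval_eq_iff_or.1 e
    · omega
  have hsymm : ∀ β β', (φ.symm β).1 = (φ.symm β').1 → β.1 = β'.1 :=
    fun β β' e => congrArg Subtype.val (φ.symm.injective (Subtype.ext e))
  have hp := h.mem_level_succ.1 hn
  have hc1 := h.add_radical_mem hn
  have hc2 := h.sub_radical_mem hn
  have k1 := key (toVertex hc1) (h.adj_of_child hc1 (h.aeval_eq_iff_or.2 (Or.inl rfl)))
  have k2 := key (toVertex hc2) (h.adj_of_child hc2 (h.aeval_eq_iff_or.2 (Or.inr rfl)))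
  have k3 := key (toVertex hp) (h.adj_of_child hn rfl).symm
  have n12 : (toVertex hc1).1 ≠ (toVertex hc2).1 := by
    intro e
    change algebraMap K _ c + radical θ c (m + 1) (φ α).1 =
      algebraMap K _ c - radical θ c (m + 1) (φ α).1 at e
    have : 2 * radical θ c (m + 1) (φ α).1 = 0 := by linear_combination e
    exact h.radical_ne_zero hn (by simpa using this)
  have n13 : (toVertex hc1).1 ≠ (toVertex hp).1 := fun e => by
    have := h.level_unique (e ▸ hc1 : (toVertex hp).1 ∈ level θ (m + 1 + 1)) hp
    omega
  have n23 : (toVertex hc2).1 ≠ (toVertex hp).1 := fun e => by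
    have := h.level_unique (e ▸ hc2 : (toVertex hp).1 ∈ level θ (m + 1 + 1)) hp
    omega
  rcases k1 with k1 | k1 <;> rcases k2 with k2 | k2 <;> rcases k3 with k3 | k3
  all_goals first
    | exact n12 (hsymm _ _ (k1.trans k2.symm))
    | exact n13 (hsymm _ _ (k1.trans k3.symm))
    | exact n23 (hsymm _ _ (k2.trans k3.symm))

/-- The two claims need a joint induction: the image of a child of `α` is a neighbour of `φ α`, and
it cannot be the parent of `φ α` because that is already the image of the parent of `α`. -/
theorem map_level_and_child [CharZero K] (φ : preimageTree θ ≃g preimageTree θ) (m : ℕ)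
    (α : Vertex θ) (hα : α.1 ∈ level θ m) :
    (φ α).1 ∈ level θ m ∧ ∀ β : Vertex θ, β.1 ∈ level θ (m + 1) → aeval β.1 (θ m) = α.1 →
      (φ β).1 ∈ level θ (m + 1) ∧ aeval (φ β).1 (θ m) = (φ α).1 := by
  induction m generalizing α with
  | zero =>
    have h1 := h.map_level_zero φ hα
    refine ⟨h1, fun β hβ e => ?_⟩
    rcases h.child_or_parent_of_adj h1 (φ.map_adj_iff.2 (h.adj_of_child hβ e)) with h2 | ⟨k, hk, _⟩
    · exact h2
    · omega
  | succ m ih =>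
    have hp := h.mem_level_succ.1 hα
    have hq := (ih (toVertex hp) hp).2 α hα rfl
    refine ⟨hq.1, fun β hβ e => ?_⟩
    rcases h.child_or_parent_of_adj hq.1 (φ.map_adj_iff.2 (h.adj_of_child hβ e)) with
      h2 | ⟨k, hk, e2⟩
    · exact h2
    · exfalso
      obtain rfl : m = k := by omega
      have e3 : β = toVertex hp := φ.injective (Subtype.ext (e2.trans hq.2))
      rw [e3] at hβ
      have := h.level_unique hβ hp
      omega

theorem map_mem_level_iso [CharZero K] (φ : preimageTree θ ≃g preimageTree θ) {m : ℕ}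
    {α : Vertex θ} (hα : α.1 ∈ level θ m) : (φ α).1 ∈ level θ m :=
  (h.map_level_and_child φ m α hα).1

theorem aeval_map_iso [CharZero K] (φ : preimageTree θ ≃g preimageTree θ) {m : ℕ}
    {α β : Vertex θ} (hβ : β.1 ∈ level θ (m + 1)) (e : aeval β.1 (θ m) = α.1) :
    aeval (φ β).1 (θ m) = (φ α).1 :=
  ((h.map_level_and_child φ m α (e ▸ h.mem_level_succ.1 hβ)).2 β hβ e).2

theorem agree_of_agree_succ [CharZero K] {σ : AlgebraicClosure K ≃ₐ[K] AlgebraicClosure K}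
    {φ : preimageTree θ ≃g preimageTree θ} {n : ℕ} (hσ : Agree σ φ (n + 1)) : Agree σ φ n := by
  intro α hα
  have hc := h.add_radical_mem hα
  have e : aeval (toVertex hc).1 (θ n) = α.1 := h.aeval_eq_iff_or.2 (Or.inl rfl)
  rw [← h.aeval_map_iso φ hc e, hσ _ hc]
  exact (aeval_algHom_apply σ.toAlgHom _ _).trans (congrArg σ e)

theorem exists_agree_succ [CharZero K]
    {σ : AlgebraicClosure K ≃ₐ[K] AlgebraicClosure K} {φ : preimageTree θ ≃g preimageTree θ}
    {n : ℕ} (hnot : ∏ x : level θ n, radical θ c n x ∉ levelField θ n) (hσ : Agree σ φ n) :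
    ∃ σ', Agree σ' φ (n + 1) := by
  classical
  have key : ∀ (α : Vertex θ) (hα : α.1 ∈ level θ n) (β : Vertex θ), β.1 ∈ level θ (n + 1) →
      aeval β.1 (θ n) = α.1 →
      (φ β).1 = algebraMap K _ c + σ (radical θ c n α.1) ∨
      (φ β).1 = algebraMap K _ c - σ (radical θ c n α.1) := by
    intro α hα β hβ e
    have h1 := h.aeval_eq_iff_or.1 (h.aeval_map_iso φ hβ e)
    rw [hσ α hα] at h1
    rcases map_radical θ c n α.1 σ with e2 | e2 <;> rw [e2]
    · exact h1
    · rw [sub_neg_eq_add, ← sub_eq_add_neg]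
      exact h1.symm
  -- Above `x`, `φ` sends `c + r` to `c + σ r` or `c - σ r`; `τ` is to flip `r` exactly in the
  -- second case, so that `σ * τ` agrees with `φ` there.
  obtain ⟨τ, hτ, hflip⟩ := h.exists_flip_eq hnot fun x =>
    if (φ (toVertex (h.add_radical_mem x.2))).1 = algebraMap K _ c + σ (radical θ c n x)
    then 0 else 1
  refine ⟨σ * τ, fun β hβ => ?_⟩
  have hx := h.mem_level_succ.1 hβ
  set x := aeval β.1 (θ n) with hxdef
  have hτr := map_radical_eq_parity c hτ ⟨x, hx⟩
  rw [hflip] at hτr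
  dsimp only at hτr
  set Y := toVertex (h.add_radical_mem hx) with hY
  have kY := key (toVertex hx) hx Y (h.add_radical_mem hx) (h.aeval_eq_iff_or.2 (Or.inl rfl))
  have kβ := key (toVertex hx) hx β hβ rfl
  change _ ∨ _ at kY
  change (φ β).1 = σ (τ β.1)
  have hne : algebraMap K _ c + σ (radical θ c n x) ≠ algebraMap K _ c - σ (radical θ c n x) := by
    intro e
    have : 2 * σ (radical θ c n x) = 0 := by linear_combination e
    exact h.radical_ne_zero hx (by simpa using this)
  have hne' : algebraMap K _ c + radical θ c n x ≠ algebraMap K _ c - radical θ c n x := by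
    intro e
    have : 2 * radical θ c n x = 0 := by linear_combination e
    exact h.radical_ne_zero hx (by simpa using this)
  have hYβ : β.1 = algebraMap K _ c - radical θ c n x → (φ β).1 ≠ (φ Y).1 := fun e e' =>
    hne' ((congrArg Subtype.val (φ.injective (Subtype.ext e'))).symm.trans e)
  rcases kY with kY | kY
  · have hr : τ (radical θ c n x) = radical θ c n x := by
      rw [hτr, if_pos (by exact kY)]; simp [parity]
    rcases h.aeval_eq_iff_or.1 hxdef.symm with e | e
    · have : β = Y := Subtype.ext e
      rw [this, kY, hY]
      simp [toVertex, hr]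
    · rw [kβ.resolve_left fun e' => hYβ e (e'.trans kY.symm), e]
      simp [toVertex, hr]
  · have hr : τ (radical θ c n x) = -radical θ c n x := by
      rw [hτr, if_neg (by exact fun e => hne (e.symm.trans kY))]; simp [parity]
    rcases h.aeval_eq_iff_or.1 hxdef.symm with e | e
    · have : β = Y := Subtype.ext e
      rw [this, kY, hY]
      simp [toVertex, hr, sub_eq_add_neg]
    · rw [kβ.resolve_right fun e' => hYβ e (e'.trans kY.symm), e]
      simp [toVertex, hr]

/-- The action of the automorphism group of the tree on a level. -/
def isoPerm [CharZero K] (n : ℕ) :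
    (preimageTree θ ≃g preimageTree θ) →* Equiv.Perm {α : Vertex θ // α.1 ∈ level θ n} where
  toFun φ :=
    { toFun := fun α => ⟨φ α, h.map_mem_level_iso φ α.2⟩
      invFun := fun α => ⟨φ.symm α, h.map_mem_level_iso φ.symm α.2⟩
      left_inv := fun α => Subtype.ext (φ.symm_apply_apply α.1)
      right_inv := fun α => Subtype.ext (φ.apply_symm_apply α.1) }
  map_one' := rfl
  map_mul' _ _ := rfl

theorem finiteIndex_range [CharZero K] {N : ℕ}
    (hnot : ∀ n ≥ N, ∏ x : level θ n, radical θ c n x ∉ levelField θ n) :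
    (arborealRep θ).range.FiniteIndex := by
  have : Finite {α : Vertex θ // α.1 ∈ level θ N} :=
    Finite.of_injective (fun α => (⟨α.1.1, α.2⟩ : level θ N)) fun α β e =>
      Subtype.ext (Subtype.ext (show α.1.1 = β.1.1 from congrArg (fun x => x.1) e))
  have hker : (h.isoPerm N).ker.FiniteIndex := Subgroup.finiteIndex_ker _
  refine Subgroup.finiteIndex_of_le (H := (h.isoPerm N).ker) fun φ hφ => ?_
  have hne : ∀ i, {σ | Agree σ φ (N + i)}.Nonempty := by
    intro i
    induction i with
    | zero =>
      refine ⟨1, fun α hα => ?_⟩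
      have := DFunLike.congr_fun (MonoidHom.mem_ker.1 hφ) ⟨α, hα⟩
      exact congrArg (fun β : {α : Vertex θ // α.1 ∈ level θ N} => β.1.1) this
    | succ i ih =>
      obtain ⟨σ, hσ⟩ := ih
      exact h.exists_agree_succ (hnot (N + i) (Nat.le_add_right _ _)) hσ
  -- The elements found at different levels need not be compatible. The sets of all solutions are
  -- closed, nonempty and decreasing in the compact absolute Galois group, so they share an element.
  obtain ⟨σ, hσ⟩ := IsCompact.nonempty_iInter_of_sequence_nonempty_isCompact_isClosed
    (fun i => {σ | Agree σ φ (N + i)}) (fun i σ hσ => h.agree_of_agree_succ hσ) hne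
    (isClosed_setOf_agree φ _).isCompact (fun i => isClosed_setOf_agree φ _)
  rw [Set.mem_iInter] at hσ
  refine mem_range_arborealRep (σ := σ) fun n => ?_
  have hanti : Antitone fun n => Agree σ φ n := antitone_nat_of_succ_le fun n =>
    h.agree_of_agree_succ
  exact hanti (Nat.le_add_left n N) (hσ n)

end IsIrreducibleSequence

/-- A sequence of quadratic polynomials whose good primes exist at almost all indices has an
arboreal representation with finite index image. -/
theorem injective_and_finiteIndex [CharZero K] (hdeg : ∀ i, (θ i).natDegree = 2)
    (hcrit : ∀ i, (θ i).derivative.eval c = 0)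
    (hirr : ∀ m, 1 ≤ m → Irreducible (rightIter θ m))
    (hgood : ∃ N : ℕ, ∀ n ≥ N, ∃ v : Valuation K ℤᵐ⁰, v c ≤ 1 ∧
      (∀ i j, v ((θ i).coeff j) ≤ 1) ∧ IsGoodAt v θ c n) :
    Function.Injective (arborealRep θ) ∧ (arborealRep θ).range.FiniteIndex := by
  refine ⟨arborealRep_injective θ, ?_⟩
  have h : IsIrreducibleSequence θ c := ⟨hdeg, hcrit, fun m => by
    rcases m with _ | m
    · exact irreducible_X
    · exact hirr _ (Nat.le_add_left 1 m)⟩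
  obtain ⟨N, hN⟩ := hgood
  refine h.finiteIndex_range (N := N) fun n hn => ?_
  -- The obstruction at level `n` comes from the good prime of index `n + 1`.
  obtain ⟨v, hc, hcoeff, hv⟩ := hN (n + 1) (hn.trans n.le_succ)
  refine h.prod_radical_notMem hc (fun i => ?_) hv
  rw [eval_eq_sum_range]
  refine v.map_sum_le fun j _ => ?_
  rw [map_mul, map_pow]
  exact mul_le_one₀ (hcoeff i j) zero_le (pow_le_one₀ zero_le hc)

end TreeAutomorphism

end Arboreal

end

theorem mainTheorem10 :
    -- number fields
    (∀ (K : Type*) [Field K] [NumberField K] (S : Set K[X]) (c : K)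
      (_ : Arboreal.IsQuadraticSet (algebraMap (𝓞 K) K).range S c)
      (θ : ℕ → K[X]) (_ : ∀ i, θ i ∈ S)
      (_ : ∀ m, 1 ≤ m → Irreducible (Arboreal.rightIter θ m))
      (_ : ∃ N : ℕ, ∀ n ≥ N, ∃ 𝔭 : HeightOneSpectrum (𝓞 K),
        Arboreal.IsGoodAt (𝔭.valuation K) θ c n),
      Function.Injective (Arboreal.arborealRep θ) ∧
        (Arboreal.arborealRep θ).range.FiniteIndex) ∧
    -- function fields of characteristic zero
    (∀ (k K : Type*) [Field k] [CharZero k] [Field K] [Algebra (RatFunc k) K] [FunctionField k K]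
      (𝔭₀ : Arboreal.FunctionFieldPrime k K) (S : Set K[X]) (c : K)
      (_ : Arboreal.IsQuadraticSet (Arboreal.integersAway 𝔭₀) S c)
      (θ : ℕ → K[X]) (_ : ∀ i, θ i ∈ S)
      (_ : ∀ m, 1 ≤ m → Irreducible (Arboreal.rightIter θ m))
      (_ : ∃ N : ℕ, ∀ n ≥ N, ∃ 𝔭 : Arboreal.FunctionFieldPrime k K, 𝔭 ≠ 𝔭₀ ∧
        Arboreal.IsGoodAt 𝔭.valuation θ c n),
      Function.Injective (Arboreal.arborealRep θ) ∧
        (Arboreal.arborealRep θ).range.FiniteIndex) := by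

  refine ⟨?_, ?_⟩
  · intro K _ _ S c hS θ hθ hirr hgood
    obtain ⟨hc, hS⟩ := hS
    refine Arboreal.injective_and_finiteIndex (fun i => (hS _ (hθ i)).1)
      (fun i => (hS _ (hθ i)).2.2) hirr ?_
    obtain ⟨N, hN⟩ := hgood
    refine ⟨N, fun n hn => ?_⟩
    obtain ⟨𝔭, h𝔭⟩ := hN n hn
    have hint : ∀ x ∈ (algebraMap (𝓞 K) K).range, 𝔭.valuation K x ≤ 1 := by
      rintro _ ⟨x, rfl⟩
      exact 𝔭.valuation_le_one x
    exact ⟨𝔭.valuation K, hint c hc, fun i j => hint _ ((hS _ (hθ i)).2.1 j), h𝔭⟩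
  · intro k K _ _ _ _ _ 𝔭₀ S c hS θ hθ hirr hgood
    obtain ⟨hc, hS⟩ := hS
    have : CharZero (RatFunc k) :=
      charZero_of_injective_algebraMap (algebraMap k (RatFunc k)).injective
    have : CharZero K := charZero_of_injective_algebraMap (algebraMap (RatFunc k) K).injective
    refine Arboreal.injective_and_finiteIndex (fun i => (hS _ (hθ i)).1)
      (fun i => (hS _ (hθ i)).2.2) hirr ?_
    obtain ⟨N, hN⟩ := hgood
    refine ⟨N, fun n hn => ?_⟩
    obtain ⟨𝔭, hne, h𝔭⟩ := hN n hn
    -- Membership in `integersAway 𝔭₀` bounds values only at primes other than `𝔭₀`, hence the role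
    -- of `hne`.
    exact ⟨𝔭.valuation, hc 𝔭 hne, fun i j => (hS _ (hθ i)).2.1 j 𝔭 hne, h𝔭⟩
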